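/- Let $f\colon\mathbb{R}^n\times\mathbb{R}^m\to\mathbb{R}^n$ be of class $C^1$ in a neighborhood of $(0,0)$ with $f(0,0)=0$, let $A:=\nabla_x f(0,0)$, and let $\Lambda(A)\subset\mathbb{C}$ be the set of complex eigenvalues of $A$. All spaces carry Euclidean norms, and $\mathbb{B}_r(z)$ is the closed ball with center $z$ and radius $r$. We say that $f$ is linearly open around $(0,0)$ with modulus $\kappa>0$ if there is a neighborhood $U$ of $(0,0)$ such that $\mathbb{B}_{\kappa r}(f(z))\subset f(\mathbb{B}_r(z))$ for all $z\in U$ and $r>0$ with $\mathbb{B}_r(z)\subset U$, and we denote by $\operatorname{cov} f(0,0)\in[0,\infty]$ the supremum of all such moduli $\kappa$ (with $\sup\emptyset:=0$). Suppose that $\Lambda(A)\subset\mathbb{R}$, and that $f$ is linearly open around $(0,0)$ with $\operatorname{cov} f(0,0)>\kappa$ for some constant $\kappa>0$ satisfying $$\kappa>\tilde\eta_c:=\max\{|\lambda| : \lambda\in\Lambda(A)\}\qquad(\max\emptyset:=0\text{ if }n=0).$$ Then the control system $\dot x=f(x,u)$ is locally exponentially stabilizable by means of continuous stationary feedback laws;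 that is, there exist a continuous map $u\colon\mathbb{R}^n\to\mathbb{R}^m$ with $u(0)=0$ and constants $\alpha>0$, $M>0$, $\delta>0$ such that for every $x_0\in\mathbb{R}^n$ with $\|x_0\|<\delta$ the closed-loop system $\dot x=f(x,u(x))$ with $x(0)=x_0$ has a solution $x(t,x_0)$ on $[0,\infty)$, every solution of this initial value problem on an interval $[0,T]$ with $T>0$ coincides with it on $[0,T]$, and $$\|x(t,x_0)\|\le M e^{-\alpha t}\|x_0\|\quad\text{for all } t\ge 0.$$ -/

import Mathlib

open Topology
open scoped NNReal ENNReal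

noncomputable section

/-- The space `ℝⁿ` with its Euclidean norm. -/
abbrev EucSpace (n : ℕ) : Type := EuclideanSpace ℝ (Fin n)

/-- The space `ℝⁿ × ℝᵐ` of state-control pairs, with the Euclidean norm of `ℝⁿ⁺ᵐ`. -/
abbrev StateControl (n m : ℕ) : Type := WithLp 2 (EucSpace n × EucSpace m)

/-- The state-control pair `(x, u)`. -/
abbrev stateControl {n m : ℕ} (x : EucSpace n) (u : EucSpace m) : StateControl n m :=
  WithLp.toLp 2 (x, u)

/-- `f` has the covering property around `z₀` with modulus `κ`: there is a neighborhood `U` of `z₀`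
such that `𝔹_{κ r}(f z) ⊆ f (𝔹_r(z))` whenever `z ∈ U`, `r > 0` and `𝔹_r(z) ⊆ U`, where `𝔹` denotes
closed balls. (Used for `κ > 0` only.) -/
def LinearlyOpenWith {X Y : Type*} [PseudoMetricSpace X] [PseudoMetricSpace Y]
    (f : X → Y) (z₀ : X) (κ : ℝ) : Prop :=
  ∃ U ∈ 𝓝 z₀, ∀ z ∈ U, ∀ r : ℝ, 0 < r → Metric.closedBall z r ⊆ U →
    Metric.closedBall (f z) (κ * r) ⊆ f '' Metric.closedBall z r

/-- `f` is linearly open around `z₀`, with some positive modulus. -/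
def LinearlyOpen {X Y : Type*} [PseudoMetricSpace X] [PseudoMetricSpace Y]
    (f : X → Y) (z₀ : X) : Prop :=
  ∃ κ : ℝ, 0 < κ ∧ LinearlyOpenWith f z₀ κ

/-- The exact covering bound `cov f(z₀)`: the supremum in `[0, ∞]` of all moduli of linear openness
of `f` around `z₀`. -/
def covBound {X Y : Type*} [PseudoMetricSpace X] [PseudoMetricSpace Y]
    (f : X → Y) (z₀ : X) : ℝ≥0∞ :=
  sSup {c | ∃ κ : ℝ, 0 < κ ∧ LinearlyOpenWith f z₀ κ ∧ c = ENNReal.ofReal κ}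

/-- The partial Jacobian matrix `A = ∇ₓ f(0,0)`, with entries `∂fᵢ/∂xⱼ (0,0)`. -/
def stateJacobian {n m : ℕ} (f : StateControl n m → EucSpace n) : Matrix (Fin n) (Fin n) ℝ :=
  Matrix.of fun i j =>
    fderiv ℝ (fun x : EucSpace n => f (stateControl x 0)) 0 (EuclideanSpace.single j 1) i

/-- A real square matrix regarded as a complex one; its `spectrum ℂ` is the complex spectrum. -/
def complexify {n : ℕ} (A : Matrix (Fin n) (Fin n) ℝ) : Matrix (Fin n) (Fin n) ℂ :=
  A.map Complex.ofReal

/-- The right-hand side of the closed-loop system `ẋ = f(x, u(x))`. -/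
def closedLoop {n m : ℕ} (f : StateControl n m → EucSpace n) (u : EucSpace n → EucSpace m) :
    EucSpace n → EucSpace n :=
  fun x => f (stateControl x (u x))

/-- The control system `ẋ = f(x, u)` is locally exponentially stabilizable by means of continuous
stationary feedback laws: for some continuous feedback `u` with `u 0 = 0` and some positive `α`, `M`,
`δ`, each initial point `x₀` with `‖x₀‖ < δ` is the starting point of a solution on `[0, ∞)` of the
closed-loop system, which decays as required, and which is the unique one: every solution on some
`[0, T]` that starts at `x₀` coincides with it there (so also every solution on `[0, ∞)`).
`IsIntegralCurveOn` with the time-independent field `fun _ => closedLoop f u` says that the curve is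
differentiable on the given time interval (one-sidedly at endpoints) and satisfies the equation
there. -/
def LocallyExpStabilizable {n m : ℕ} (f : StateControl n m → EucSpace n) : Prop :=
  ∃ u : EucSpace n → EucSpace m, Continuous u ∧ u 0 = 0 ∧
    ∃ α M δ : ℝ, 0 < α ∧ 0 < M ∧ 0 < δ ∧
      ∀ x₀ : EucSpace n, ‖x₀‖ < δ →
        ∃ x : ℝ → EucSpace n,
          x 0 = x₀ ∧
          IsIntegralCurveOn x (fun _ => closedLoop f u) (Set.Ici 0) ∧
          (∀ t : ℝ, 0 ≤ t → ‖x t‖ ≤ M * Real.exp (-α * t) * ‖x₀‖) ∧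
          ∀ (T : ℝ) (y : ℝ → EucSpace n), 0 < T → y 0 = x₀ →
            IsIntegralCurveOn y (fun _ => closedLoop f u) (Set.Icc 0 T) →
            Set.EqOn y x (Set.Icc 0 T)

end

/-! Write `D = (A, B)` for the derivative of `f` at the origin. Testing openness on one extremal
point of each small image ball gives `κ‖p‖ ≤ ‖D* p‖` (`LinearlyOpenWith.mul_norm_le_norm_adjoint`).
If a nonzero `A*`-invariant subspace lay in `ker B*`, real spectrum would put a real eigenvector `p`
of `A*` in it, with eigenvalue `r`; then `D* p = (A* p, 0)`, so `κ‖p‖ ≤ |r|‖p‖`, against `|r| < κ`.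
Hence the linearization is controllable in Hautus form (`eq_bot_of_invariant_of_linearlyOpenWith`).

Controllability yields a linear feedback `K` and a quadratic Lyapunov function for `A + B K`
(`exists_feedback_of_controllable`). The same `K` serves the nonlinear system by Lyapunov's indirect
method (`exists_exponential_stability`). As `f` is `C¹`, the closed loop is Lipschitz near the
origin, which gives existence and uniqueness of solutions. -/

/-! ### Stabilization of controllable linear systems. -/

section LinearFeedback

open scoped InnerProductSpace
open ContinuousLinearMap (adjoint adjoint_inner_left adjoint_inner_right)

variable {E F : Type*} [NormedAddCommGroup E] [InnerProductSpace ℝ E] [FiniteDimensional ℝ E]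
  [NormedAddCommGroup F] [InnerProductSpace ℝ F] [FiniteDimensional ℝ F]

/-- The Lyapunov operator `W ↦ A W + W A* + 2 β W` is injective when `‖A‖ < β`. -/
theorem lyapunov_operator_injective (A : E →L[ℝ] E) {β : ℝ} (hβ : ‖A‖ < β) {W : E →L[ℝ] E}
    (h : A ∘L W + W ∘L adjoint A + (2 * β) • W = 0) : W = 0 := by
  have hβ0 : 0 ≤ β := (norm_nonneg A).trans hβ.le
  have h1 : (2 * β) • W = -(A ∘L W + W ∘L adjoint A) := eq_neg_of_add_eq_zero_right h
  have h2 : 2 * β * ‖W‖ ≤ 2 * ‖A‖ * ‖W‖ := by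
    calc 2 * β * ‖W‖ = ‖(2 * β) • W‖ := by
          rw [norm_smul, Real.norm_of_nonneg (by positivity)]
      _ = ‖A ∘L W + W ∘L adjoint A‖ := by rw [h1, norm_neg]
      _ ≤ ‖A‖ * ‖W‖ + ‖W‖ * ‖adjoint A‖ := (norm_add_le _ _).trans
          (add_le_add (A.opNorm_comp_le W) (W.opNorm_comp_le _))
      _ = 2 * ‖A‖ * ‖W‖ := by rw [LinearIsometryEquiv.norm_map]; ring
  rw [← norm_le_zero_iff]
  by_contra! hW
  nlinarith

theorem exists_lyapunov_solution (A Q : E →L[ℝ] E) (hQ : adjoint Q = Q) {β : ℝ} (hβ : ‖A‖ < β) :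
    ∃ W : E →L[ℝ] E, adjoint W = W ∧ A ∘L W + W ∘L adjoint A + (2 * β) • W = Q := by
  let L : (E →L[ℝ] E) →ₗ[ℝ] (E →L[ℝ] E) :=
    { toFun := fun W => A ∘L W + W ∘L adjoint A + (2 * β) • W
      map_add' := fun V W => by
        ext x
        simp only [add_apply, ContinuousLinearMap.comp_apply,
          smul_apply, map_add, smul_add]
        abel
      map_smul' := fun c W => by
        ext x
        simp only [add_apply, ContinuousLinearMap.comp_apply,
          smul_apply, map_smul, smul_add, RingHom.id_apply]
        rw [smul_comm c (2 * β)] }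
  have hL : Function.Injective L := by
    rw [injective_iff_map_eq_zero]
    exact fun W hW => lyapunov_operator_injective A hβ hW
  obtain ⟨W, hW⟩ := LinearMap.injective_iff_surjective.1 hL Q
  -- As `Q` is self-adjoint, `adjoint W` solves the same equation, so uniqueness gives `adjoint W =
  -- W`.
  refine ⟨W, hL ?_, hW⟩
  rw [hW]
  change A ∘L adjoint W + adjoint W ∘L adjoint A + (2 * β) • adjoint W = Q
  rw [← hQ, ← hW]
  change _ = adjoint (A ∘L W + W ∘L adjoint A + (2 * β) • W)
  rw [map_add, map_add, ContinuousLinearMap.adjoint_comp, ContinuousLinearMap.adjoint_comp,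
    ContinuousLinearMap.adjoint_adjoint]
  have : adjoint ((2 * β) • W) = (2 * β) • adjoint W := by
    rw [LinearIsometryEquiv.map_smulₛₗ]; simp
  rw [this, add_comm (A ∘L adjoint W)]

/-- A self-adjoint operator with positive eigenvalues is positive definite. -/
theorem inner_apply_self_pos_of_eigenvalues_pos {W : E →L[ℝ] E} (hW : adjoint W = W)
    (hpos : ∀ (μ : ℝ) (p : E), p ≠ 0 → W p = μ • p → 0 < μ) {x : E} (hx : x ≠ 0) :
    0 < ⟪W x, x⟫_ℝ := by
  have hsym : (W : E →ₗ[ℝ] E).IsSymmetric := fun y z => by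
    change ⟪W y, z⟫_ℝ = ⟪y, W z⟫_ℝ
    rw [← adjoint_inner_left, hW]
  let b := hsym.eigenvectorBasis rfl
  let l := hsym.eigenvalues rfl
  have hb : ∀ i, W (b i) = l i • b i := fun i => hsym.apply_eigenvectorBasis rfl i
  have hl : ∀ i, 0 < l i := fun i =>
    hpos _ _ (by rw [← norm_ne_zero_iff, b.orthonormal.1 i]; exact one_ne_zero) (hb i)
  have hsum : ⟪W x, x⟫_ℝ = ∑ i, l i * ⟪b i, x⟫_ℝ ^ 2 := by
    rw [← b.sum_inner_mul_inner]
    refine Finset.sum_congr rfl fun i _ => ?_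
    have : ⟪W x, b i⟫_ℝ = l i * ⟪b i, x⟫_ℝ := by
      rw [← hW, adjoint_inner_left, hb, inner_smul_right, real_inner_comm]
    rw [this]; ring
  rw [hsum]
  refine Finset.sum_pos' (fun i _ => mul_nonneg (hl i).le (sq_nonneg _)) ?_
  by_contra! hcon
  refine hx ?_
  rw [← inner_self_eq_zero (𝕜 := ℝ), ← b.sum_inner_mul_inner]
  refine Finset.sum_eq_zero fun i hi => ?_
  have h0 : ⟪b i, x⟫_ℝ ^ 2 = 0 := by
    refine le_antisymm ?_ (sq_nonneg _)
    by_contra! h'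
    exact absurd (hcon i hi) (not_le.2 (mul_pos (hl i) h'))
  rw [pow_eq_zero_iff two_ne_zero] at h0
  rw [h0, mul_zero]

/-- Bass' construction of a stabilizing linear feedback: if no nonzero `A*`-invariant subspace is
contained in the kernel of `B*`, then for some feedback `K` the closed loop `A + B K` admits a
quadratic Lyapunov function `⟪P x, x⟫`. -/
theorem exists_feedback_of_controllable (A : E →L[ℝ] E) (B : F →L[ℝ] E)
    (h : ∀ S : Submodule ℝ E, (∀ p ∈ S, adjoint A p ∈ S) → (∀ p ∈ S, adjoint B p = 0) → S = ⊥) :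
    ∃ (K : E →L[ℝ] F) (P : E →L[ℝ] E) (β : ℝ), 0 < β ∧ (∀ x y, ⟪P x, y⟫_ℝ = ⟪x, P y⟫_ℝ) ∧
      (∀ x, x ≠ 0 → 0 < ⟪P x, x⟫_ℝ) ∧ ∀ x, ⟪P x, A x + B (K x)⟫_ℝ = -β * ⟪P x, x⟫_ℝ := by
  -- Any `β > ‖A‖` works: it makes the Lyapunov equation solvable and `A + β` positive as a
  -- quadratic form.
  let β : ℝ := ‖A‖ + 1
  have hβ0 : 0 < β := by positivity
  obtain ⟨W, hW, hWeq⟩ := exists_lyapunov_solution A ((2 : ℝ) • (B ∘L adjoint B))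
    (by rw [LinearIsometryEquiv.map_smulₛₗ, ContinuousLinearMap.adjoint_comp,
      ContinuousLinearMap.adjoint_adjoint]; simp) (lt_add_one ‖A‖ : ‖A‖ < β)
  have hWsym : ∀ x y, ⟪W x, y⟫_ℝ = ⟪x, W y⟫_ℝ := fun x y => by
    rw [← adjoint_inner_left, hW]
  have hWx : ∀ x, A (W x) + W (adjoint A x) + (2 * β) • W x = (2 : ℝ) • B (adjoint B x) :=
    fun x => by simpa using congrArg (fun T : E →L[ℝ] E => T x) hWeq
  have hquad : ∀ p, ⟪p, A (W p)⟫_ℝ + β * ⟪p, W p⟫_ℝ = ‖adjoint B p‖ ^ 2 := fun p => by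
    have h1 := congrArg (fun y => ⟪p, y⟫_ℝ) (hWx p)
    simp only [inner_add_right, inner_smul_right] at h1
    have h2 : ⟪p, W (adjoint A p)⟫_ℝ = ⟪p, A (W p)⟫_ℝ := by
      rw [← hWsym, adjoint_inner_right, real_inner_comm]
    have h3 : ⟪p, B (adjoint B p)⟫_ℝ = ‖adjoint B p‖ ^ 2 := by
      rw [← adjoint_inner_left, real_inner_self_eq_norm_sq]
    rw [h2, h3] at h1
    linarith
  -- On `ker W`, `hquad` forces `B* p = 0`, and then the equation for `W` gives `W (A* p) = 0`. So
  -- `ker W` is one of the subspaces excluded by `h`.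
  have hker : LinearMap.ker (W : E →ₗ[ℝ] E) = ⊥ := by
    have hB : ∀ p ∈ LinearMap.ker (W : E →ₗ[ℝ] E), adjoint B p = 0 := fun p hp => by
      have hp' : W p = 0 := hp
      have := hquad p
      rw [hp'] at this
      simpa using this.symm
    refine h _ (fun p hp => ?_) hB
    have hp' : W p = 0 := hp
    have := hWx p
    rw [hp', hB p hp] at this
    simpa using this
  have hinj : Function.Injective (W : E →ₗ[ℝ] E) := LinearMap.ker_eq_bot.1 hker
  -- For an eigenpair `(μ, p)`, `hquad` reads `μ (⟪p, A p⟫ + β‖p‖²) = ‖B* p‖² ≥ 0` with a positive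
  -- bracket, so `μ ≥ 0`; injectivity excludes `μ = 0`.
  have hWpos : ∀ x, x ≠ 0 → 0 < ⟪W x, x⟫_ℝ := fun x hx => by
    refine inner_apply_self_pos_of_eigenvalues_pos hW (fun μ p hp hμ => ?_) hx
    have hμ0 : μ ≠ 0 := by
      rintro rfl
      rw [zero_smul] at hμ
      exact hp (hinj (by simpa using hμ))
    have h1 := hquad p
    rw [hμ, map_smul, inner_smul_right, inner_smul_right, real_inner_self_eq_norm_sq] at h1
    have h2 : -(‖A‖ * ‖p‖ ^ 2) ≤ ⟪p, A p⟫_ℝ := by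
      have h3 := abs_le.1 ((abs_real_inner_le_norm p (A p)).trans
        (mul_le_mul_of_nonneg_left (A.le_opNorm p) (norm_nonneg p)))
      nlinarith [h3.1]
    have hp2 : 0 < ‖p‖ ^ 2 := by have := norm_pos_iff.2 hp; positivity
    have h4 : 0 < ⟪p, A p⟫_ℝ + β * ‖p‖ ^ 2 := by
      simp only [β]; nlinarith
    have h5 : 0 ≤ μ * (⟪p, A p⟫_ℝ + β * ‖p‖ ^ 2) := by
      nlinarith [sq_nonneg ‖adjoint B p‖]
    exact lt_of_le_of_ne (nonneg_of_mul_nonneg_left h5 h4) hμ0.symm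
  let e : E ≃ₗ[ℝ] E := LinearEquiv.ofInjectiveEndo (W : E →ₗ[ℝ] E) hinj
  let P : E →L[ℝ] E := LinearMap.toContinuousLinearMap (e.symm : E →ₗ[ℝ] E)
  have hWP : ∀ x, W (P x) = x := fun x => e.apply_symm_apply x
  -- With `P = W⁻¹` and `K = -B* P`, the feedback term cancels `‖B* P x‖²` in `hquad (P x)`, leaving
  -- an exact equality.
  refine ⟨-(adjoint B ∘L P), P, β, hβ0, fun x y => ?_, fun x hx => ?_, fun x => ?_⟩
  · conv_lhs => rw [← hWP y]
    rw [← hWsym, hWP]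
  · have hPx : P x ≠ 0 := fun h0 => hx (by rw [← hWP x, h0, map_zero])
    have := hWpos _ hPx
    rwa [hWP, real_inner_comm] at this
  · have h1 := hquad (P x)
    rw [hWP] at h1
    have h3 : ⟪P x, B (adjoint B (P x))⟫_ℝ = ‖adjoint B (P x)‖ ^ 2 := by
      rw [← adjoint_inner_left, real_inner_self_eq_norm_sq]
    simp only [neg_apply, ContinuousLinearMap.comp_apply, map_neg,
      inner_add_right, inner_neg_right]
    linarith

end LinearFeedback

/-! ### Autonomous differential equations and Lyapunov's indirect method. -/

section AutonomousODE

open scoped InnerProductSpace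
open Metric Set

section General

variable {E : Type*} [NormedAddCommGroup E] [NormedSpace ℝ E]

theorem IsIntegralCurveOn.hasDerivWithinAt_Ici {y : ℝ → E} {v : ℝ → E → E} {T t : ℝ}
    (hy : IsIntegralCurveOn y v (Icc 0 T)) (ht : t ∈ Ico 0 T) :
    HasDerivWithinAt y (v t (y t)) (Ici t) t :=
  (hy t (Ico_subset_Icc_self ht)).mono_of_mem_nhdsWithin (Icc_mem_nhdsGE_of_mem ht)

theorem IsIntegralCurveOn.continuousOn_of_hasDerivWithinAt {y : ℝ → E} {v : ℝ → E → E} {s : Set ℝ}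
    (hy : IsIntegralCurveOn y v s) : ContinuousOn y s :=
  fun t ht => (hy t ht).continuousWithinAt

/-- Uniqueness for an autonomous equation inside a set where the field is Lipschitz. -/
theorem IsIntegralCurveOn.eqOn_Icc_of_lipschitzOnWith {g : E → E} {K : ℝ≥0} {s : Set E}
    (hg : LipschitzOnWith K g s) {x y : ℝ → E} {T : ℝ}
    (hx : IsIntegralCurveOn x (fun _ => g) (Icc 0 T)) (hxs : ∀ t ∈ Icc 0 T, x t ∈ s)
    (hy : IsIntegralCurveOn y (fun _ => g) (Icc 0 T)) (hys : ∀ t ∈ Icc 0 T, y t ∈ s)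
    (h0 : x 0 = y 0) : EqOn x y (Icc 0 T) :=
  ODE_solution_unique_of_mem_Icc_right (v := fun _ => g) (s := fun _ => s) (fun _ _ => hg)
    hx.continuousOn_of_hasDerivWithinAt (fun _ ht => hx.hasDerivWithinAt_Ici ht)
    (fun t ht => hxs t (Ico_subset_Icc_self ht))
    hy.continuousOn_of_hasDerivWithinAt (fun _ ht => hy.hasDerivWithinAt_Ici ht)
    (fun t ht => hys t (Ico_subset_Icc_self ht)) h0

/-- A bounded Lipschitz field has a solution on each interval `[0, T]`. -/
theorem exists_isIntegralCurveOn_Icc_of_bounded [CompleteSpace E] {G : E → E} {K L : ℝ≥0}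
    (hK : LipschitzWith K G) (hL : ∀ x, ‖G x‖ ≤ L) (x₀ : E) {T : ℝ} (hT : 0 ≤ T) :
    ∃ x : ℝ → E, x 0 = x₀ ∧ IsIntegralCurveOn x (fun _ => G) (Icc 0 T) := by
  have hpl : IsPicardLindelof (fun _ : ℝ => G) (tmin := 0) (tmax := T) ⟨0, left_mem_Icc.2 hT⟩ x₀
      (L * ⟨T, hT⟩) 0 L K :=
    IsPicardLindelof.of_time_independent (fun x _ => hL x) hK.lipschitzOnWith
      (by simp only [sub_zero, sub_self, max_eq_left hT, NNReal.coe_zero]; exact le_rfl)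
  exact hpl.exists_eq_forall_mem_Icc_hasDerivWithinAt₀

/-- A bounded Lipschitz field has a solution on `[0, ∞)`. -/
theorem exists_isIntegralCurveOn_Ici_of_bounded [CompleteSpace E] {G : E → E} {K L : ℝ≥0}
    (hK : LipschitzWith K G) (hL : ∀ x, ‖G x‖ ≤ L) (x₀ : E) :
    ∃ x : ℝ → E, x 0 = x₀ ∧ IsIntegralCurveOn x (fun _ => G) (Ici 0) := by
  choose z hz0 hz using fun N : ℕ =>
    exists_isIntegralCurveOn_Icc_of_bounded hK hL x₀ (Nat.cast_nonneg (α := ℝ) N)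
  have hagree : ∀ M N : ℕ, M ≤ N → EqOn (z M) (z N) (Icc 0 M) := fun M N hMN =>
    (hz M).eqOn_Icc_of_lipschitzOnWith (s := univ) hK.lipschitzOnWith (fun _ _ => mem_univ _)
      (fun t ht => (hz N t ⟨ht.1, ht.2.trans (by exact_mod_cast hMN)⟩).mono
        (Icc_subset_Icc_right (by exact_mod_cast hMN)))
      (fun _ _ => mem_univ _) ((hz0 M).trans (hz0 N).symm)
  -- The `+ 1` keeps `t` strictly below the right endpoint of the interval used.
  let x : ℝ → E := fun t => z (⌊t⌋₊ + 1) t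
  have hxz : ∀ N : ℕ, EqOn x (z N) (Icc 0 N) := fun N t ht => by
    have hmem : t ∈ Icc (0 : ℝ) ((⌊t⌋₊ + 1 : ℕ) : ℝ) :=
      ⟨ht.1, by push_cast; exact (Nat.lt_floor_add_one t).le⟩
    rcases le_total (⌊t⌋₊ + 1) N with h | h
    · exact hagree _ _ h hmem
    · exact (hagree _ _ h ht).symm
  refine ⟨x, ?_, fun t ht => ?_⟩
  · rw [hxz 0 (by simp), hz0]
  · have ht0 : (0 : ℝ) ≤ t := ht
    let N := ⌊t⌋₊ + 1
    have htN : t < N := by simpa [N] using Nat.lt_floor_add_one t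
    have hmem : t ∈ Icc (0 : ℝ) N := ⟨ht0, htN.le⟩
    have h1 : HasDerivWithinAt x (G (x t)) (Icc 0 N) t := by
      rw [hxz N hmem]
      exact (hz N t hmem).congr (hxz N) (hxz N hmem)
    refine h1.mono_of_mem_nhdsWithin ?_
    rw [← Ici_inter_Iic]
    exact Filter.inter_mem self_mem_nhdsWithin (mem_nhdsWithin_of_mem_nhds (Iic_mem_nhds htN))

end General

variable {E : Type*} [NormedAddCommGroup E] [InnerProductSpace ℝ E]

/-- Exponential decay of a quadratic Lyapunov function along a solution that starts in a sublevel
set on which the Lyapunov inequality holds. -/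
theorem quadratic_lyapunov_decay {g : E → E} {P : E →L[ℝ] E} {α c : ℝ} (hα : 0 ≤ α)
    (hP : ∀ x y, ⟪P x, y⟫_ℝ = ⟪x, P y⟫_ℝ)
    (hpos : ∀ x, 0 ≤ ⟪P x, x⟫_ℝ)
    (hlyap : ∀ x, x ≠ 0 → ⟪P x, x⟫_ℝ ≤ c → ⟪P x, g x⟫_ℝ < -α * ⟪P x, x⟫_ℝ)
    {y : ℝ → E} {T : ℝ} (hy : IsIntegralCurveOn y (fun _ => g) (Icc 0 T))
    (h0 : ⟪P (y 0), y 0⟫_ℝ < c) {t : ℝ} (ht : t ∈ Icc 0 T) :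
    ⟪P (y t), y t⟫_ℝ ≤ ⟪P (y 0), y 0⟫_ℝ * Real.exp (-(2 * α) * t) := by
  -- The comparison theorem needs a strict slope inequality wherever the two curves touch. With `d >
  -- 0` a contact point is nonzero and has value at most `d < c`, so `hlyap` applies without knowing
  -- beforehand that the sublevel set is invariant. Letting `d` decrease to the initial value
  -- finishes.
  have key : ∀ d, ⟪P (y 0), y 0⟫_ℝ < d → d < c →
      ⟪P (y t), y t⟫_ℝ ≤ d * Real.exp (-(2 * α) * t) := by
    intro d hd hdc
    have hd0 : 0 < d := (hpos _).trans_lt hd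
    have hyc := hy.continuousOn_of_hasDerivWithinAt
    refine image_le_of_deriv_right_lt_deriv_boundary
      (f := fun s => ⟪P (y s), y s⟫_ℝ) (f' := fun s => 2 * ⟪P (y s), g (y s)⟫_ℝ)
      (B := fun s => d * Real.exp (-(2 * α) * s))
      (B' := fun s => d * (Real.exp (-(2 * α) * s) * (-(2 * α))))
      ((P.continuous.comp_continuousOn hyc).inner hyc) (fun s hs => ?_) (by simpa using hd.le)
      (fun s => ?_) (fun s hs heq => ?_) ht
    · have h1 := hy.hasDerivWithinAt_Ici hs
      have h2 : HasDerivWithinAt (fun s => P (y s)) (P (g (y s))) (Ici s) s :=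
        P.hasFDerivAt.comp_hasDerivWithinAt s h1
      refine (h2.inner ℝ h1).congr_deriv ?_
      rw [hP (g (y s)), real_inner_comm (P (y s))]
      ring
    · have h1 : HasDerivAt (fun s : ℝ => -(2 * α) * s) (-(2 * α)) s := by
        simpa using (hasDerivAt_id s).const_mul (-(2 * α))
      exact h1.exp.const_mul d
    · have he : Real.exp (-(2 * α) * s) ≤ 1 := Real.exp_le_one_iff.2 (by
        have := mul_nonneg hα hs.1; linarith)
      have heq' : ⟪P (y s), y s⟫_ℝ = d * Real.exp (-(2 * α) * s) := heq
      have hVc : ⟪P (y s), y s⟫_ℝ ≤ c := by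
        rw [heq']
        nlinarith
      have hne : y s ≠ 0 := fun hz => by
        rw [hz, map_zero, inner_zero_left] at heq'
        exact (mul_pos hd0 (Real.exp_pos _)).ne heq'
      have := hlyap _ hne hVc
      rw [heq'] at this
      change 2 * ⟪P (y s), g (y s)⟫_ℝ < _
      linarith
  refine ge_of_tendsto (x := 𝓝[>] ⟪P (y 0), y 0⟫_ℝ)
    (f := fun d => d * Real.exp (-(2 * α) * t)) ?_ ?_
  · exact ((continuous_id.mul continuous_const).tendsto _).mono_left nhdsWithin_le_nhds
  · filter_upwards [Ioo_mem_nhdsGT h0] with d hd using key d hd.1 hd.2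

variable [FiniteDimensional ℝ E]

/-- A field that is Lipschitz on a ball agrees on a smaller ball with a bounded Lipschitz field. -/
theorem exists_bounded_lipschitz_eqOn_closedBall {g : E → E} {K : ℝ≥0} {R : ℝ} (hR : 0 < R)
    (hg : LipschitzOnWith K g (closedBall 0 R)) :
    ∃ (G : E → E) (K' L : ℝ≥0), LipschitzWith K' G ∧ (∀ x, ‖G x‖ ≤ L) ∧
      EqOn G g (closedBall 0 (R / 2)) := by
  let φ : ContDiffBump (0 : E) := ⟨R / 2, R, by positivity, by linarith⟩
  -- A smooth compactly supported map, hence Lipschitz, into the ball of radius `R` and equal to the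
  -- identity on the half ball; `g ∘ ψ` is the required extension.
  let ψ : E → E := fun x => φ x • x
  have hψs : HasCompactSupport ψ := φ.hasCompactSupport.smul_right
  have hψc : ContDiff ℝ 1 ψ := φ.contDiff.smul contDiff_id
  obtain ⟨C, hC⟩ := hψc.lipschitzWith_of_hasCompactSupport hψs one_ne_zero
  have hψm : ∀ x, ψ x ∈ closedBall (0 : E) R := fun x => by
    rw [mem_closedBall_zero_iff]
    by_cases hx : ‖x‖ < R
    · calc ‖ψ x‖ = φ x * ‖x‖ := by rw [norm_smul, Real.norm_of_nonneg φ.nonneg]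
        _ ≤ 1 * ‖x‖ := mul_le_mul_of_nonneg_right φ.le_one (norm_nonneg x)
        _ ≤ R := by linarith
    · have : φ x = 0 := φ.zero_of_le_dist (by simpa using not_lt.1 hx)
      simp [ψ, this, hR.le]
  refine ⟨g ∘ ψ, K * C, ‖g 0‖₊ + K * ⟨R, hR.le⟩, ?_, fun x => ?_, fun x hx => ?_⟩
  · exact lipschitzOnWith_univ.1 (hg.comp hC.lipschitzOnWith fun x _ => hψm x)
  · have h1 := hg.dist_le_mul _ (hψm x) 0 (mem_closedBall_self hR.le)
    have h2 : dist (ψ x) 0 ≤ R := hψm x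
    have h3 : ‖g (ψ x)‖ ≤ ‖g 0‖ + ‖g (ψ x) - g 0‖ := norm_le_norm_add_norm_sub' _ _
    rw [dist_eq_norm] at h1
    have h4 : (K : ℝ) * dist (ψ x) 0 ≤ K * R := mul_le_mul_of_nonneg_left h2 K.2
    push_cast
    change ‖g (ψ x)‖ ≤ ‖g 0‖ + K * R
    linarith
  · have : φ x = 1 := φ.one_of_mem_closedBall hx
    simp [ψ, this]

/-- The constant is the minimum of the form on the compact unit sphere, extended by homogeneity; an
empty sphere means a trivial space. -/
theorem exists_pos_mul_norm_sq_le_inner {P : E →L[ℝ] E} (hpos : ∀ x, x ≠ 0 → 0 < ⟪P x, x⟫_ℝ) :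
    ∃ a : ℝ, 0 < a ∧ ∀ x, a * ‖x‖ ^ 2 ≤ ⟪P x, x⟫_ℝ := by
  rcases (sphere (0 : E) 1).eq_empty_or_nonempty with hS | hS
  · refine ⟨1, one_pos, fun x => ?_⟩
    rcases eq_or_ne x 0 with rfl | hx
    · simp
    · have : ‖x‖⁻¹ • x ∈ sphere (0 : E) 1 := by
        rw [mem_sphere_zero_iff_norm, norm_smul, norm_inv, norm_norm,
          inv_mul_cancel₀ (norm_ne_zero_iff.2 hx)]
      exact absurd this (hS ▸ notMem_empty _)
  · obtain ⟨z, hz, hmin⟩ := (isCompact_sphere (0 : E) 1).exists_isMinOn hS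
      ((P.continuous.inner (𝕜 := ℝ) continuous_id).continuousOn (s := sphere (0 : E) 1))
    have hz0 : z ≠ 0 := ne_zero_of_mem_unit_sphere ⟨z, hz⟩
    refine ⟨⟪P z, z⟫_ℝ, hpos z hz0, fun x => ?_⟩
    rcases eq_or_ne x 0 with rfl | hx
    · simp
    · have hn := norm_ne_zero_iff.2 hx
      have hu : ‖x‖⁻¹ • x ∈ sphere (0 : E) 1 := by
        rw [mem_sphere_zero_iff_norm, norm_smul, norm_inv, norm_norm, inv_mul_cancel₀ hn]
      have h1 : ⟪P z, z⟫_ℝ ≤ ⟪P (‖x‖⁻¹ • x), ‖x‖⁻¹ • x⟫_ℝ := hmin hu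
      rw [map_smul, inner_smul_left, inner_smul_right] at h1
      simp only [conj_trivial] at h1
      calc ⟪P z, z⟫_ℝ * ‖x‖ ^ 2 ≤ ‖x‖⁻¹ * (‖x‖⁻¹ * ⟪P x, x⟫_ℝ) * ‖x‖ ^ 2 :=
            mul_le_mul_of_nonneg_right h1 (sq_nonneg _)
        _ = ⟪P x, x⟫_ℝ := by field_simp

/-- Lyapunov's indirect method: if the linearization of `g` at the equilibrium `0` admits a
quadratic Lyapunov function, then `0` is locally exponentially stable for `ẋ = g x`, with existence
and uniqueness of solutions on `[0, ∞)`. -/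
theorem exists_exponential_stability {g : E → E} {M P : E →L[ℝ] E} {β : ℝ}
    (hg : HasStrictFDerivAt g M 0) (hg0 : g 0 = 0) (hβ : 0 < β)
    (hP : ∀ x y, ⟪P x, y⟫_ℝ = ⟪x, P y⟫_ℝ) (hpos : ∀ x, x ≠ 0 → 0 < ⟪P x, x⟫_ℝ)
    (hM : ∀ x, ⟪P x, M x⟫_ℝ = -β * ⟪P x, x⟫_ℝ) :
    ∃ α C δ : ℝ, 0 < α ∧ 0 < C ∧ 0 < δ ∧ ∀ x₀ : E, ‖x₀‖ < δ →
      ∃ x : ℝ → E, x 0 = x₀ ∧ IsIntegralCurveOn x (fun _ => g) (Ici 0) ∧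
        (∀ t : ℝ, 0 ≤ t → ‖x t‖ ≤ C * Real.exp (-α * t) * ‖x₀‖) ∧
        ∀ (T : ℝ) (y : ℝ → E), 0 < T → y 0 = x₀ →
          IsIntegralCurveOn y (fun _ => g) (Icc 0 T) → EqOn y x (Icc 0 T) := by
  obtain ⟨a, ha, haP⟩ := exists_pos_mul_norm_sq_le_inner hpos
  have hpos' : ∀ x, 0 ≤ ⟪P x, x⟫_ℝ := fun x => (by positivity : 0 ≤ a * ‖x‖ ^ 2).trans (haP x)
  let b : ℝ := ‖P‖ + 1
  have hb : 0 < b := by positivity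
  have hbP : ∀ x, ⟪P x, x⟫_ℝ ≤ b * ‖x‖ ^ 2 := fun x => by
    have h1 := real_inner_le_norm (P x) x
    have h2 := mul_le_mul_of_nonneg_right (P.le_opNorm x) (norm_nonneg x)
    simp only [b]
    nlinarith [sq_nonneg ‖x‖]
  obtain ⟨K, s, hs, hK⟩ := hg.exists_lipschitzOnWith
  -- Chosen so that the nonlinear remainder costs at most `β / 4` of the decay rate `β`, leaving
  -- strictly more than `β / 2`.
  let ε : ℝ := a * β / (4 * b)
  have hε : 0 < ε := by positivity
  have hlin : ∀ᶠ x in 𝓝 (0 : E), ‖g x - M x‖ ≤ ε * ‖x‖ := by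
    have := hg.hasFDerivAt.isLittleO.def hε
    simpa [hg0] using this
  obtain ⟨R, hR, hRs⟩ := nhds_basis_closedBall.mem_iff.1 (Filter.inter_mem hs hlin)
  have hgR : LipschitzOnWith K g (closedBall 0 R) := hK.mono fun x hx => (hRs hx).1
  obtain ⟨G, K', L, hGK, hGL, hGg⟩ := exists_bounded_lipschitz_eqOn_closedBall hR hgR
  have hRR : closedBall (0 : E) (R / 2) ⊆ closedBall 0 R := closedBall_subset_closedBall (by linarith)
  -- The sublevel set of level `c` lies in the half ball, where `G = g`.
  let c : ℝ := a * (R / 2) ^ 2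
  have hc : 0 < c := by positivity
  have hsub : ∀ x, ⟪P x, x⟫_ℝ ≤ c → x ∈ closedBall (0 : E) (R / 2) := fun x hx => by
    rw [mem_closedBall_zero_iff]
    have h1 : ‖x‖ ^ 2 ≤ (R / 2) ^ 2 := le_of_mul_le_mul_left ((haP x).trans hx) ha
    exact le_of_sq_le_sq h1 (by positivity)
  have hlyap : ∀ x, x ≠ 0 → ⟪P x, x⟫_ℝ ≤ c → ⟪P x, g x⟫_ℝ < -(β / 2) * ⟪P x, x⟫_ℝ := by
    intro x hx hxc
    have h1 : ‖g x - M x‖ ≤ ε * ‖x‖ := (hRs (hRR (hsub x hxc))).2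
    have h2 : ⟪P x, g x⟫_ℝ = ⟪P x, M x⟫_ℝ + ⟪P x, g x - M x⟫_ℝ := by
      rw [← inner_add_right]; congr 1; abel
    have h3 : ⟪P x, g x - M x⟫_ℝ ≤ b * ‖x‖ * (ε * ‖x‖) := by
      refine (real_inner_le_norm _ _).trans (mul_le_mul ?_ h1 (norm_nonneg _) (by positivity))
      exact (P.le_opNorm x).trans (mul_le_mul_of_nonneg_right (by simp [b]) (norm_nonneg x))
    have h4 : b * ‖x‖ * (ε * ‖x‖) = β / 4 * (a * ‖x‖ ^ 2) := by
      simp only [ε]; field_simp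
    have h5 := mul_le_mul_of_nonneg_left (haP x) (by positivity : 0 ≤ β / 4)
    have h6 := mul_pos (by positivity : 0 < β / 4) (hpos x hx)
    rw [h2, hM]
    linarith
  have hlyapG : ∀ x, x ≠ 0 → ⟪P x, x⟫_ℝ ≤ c → ⟪P x, G x⟫_ℝ < -(β / 2) * ⟪P x, x⟫_ℝ :=
    fun x hx hxc => by rw [hGg (hsub x hxc)]; exact hlyap x hx hxc
  refine ⟨β / 2, √(b / a), √(c / b), by positivity, by positivity, by positivity, fun x₀ hx₀ => ?_⟩
  have hx₀c : ⟪P x₀, x₀⟫_ℝ < c := by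
    have h1 : ‖x₀‖ ^ 2 < c / b := (Real.lt_sqrt (norm_nonneg _)).1 hx₀
    rw [lt_div_iff₀ hb] at h1
    linarith [hbP x₀]
  have hexp : ∀ t : ℝ, 0 ≤ t → ⟪P x₀, x₀⟫_ℝ * Real.exp (-(2 * (β / 2)) * t) ≤ c := fun t ht => by
    have : Real.exp (-(2 * (β / 2)) * t) ≤ 1 := Real.exp_le_one_iff.2 (by nlinarith)
    nlinarith [hpos' x₀]
  obtain ⟨x, hx0, hx⟩ := exists_isIntegralCurveOn_Ici_of_bounded hGK hGL x₀
  have hdecay : ∀ t, 0 ≤ t → ⟪P (x t), x t⟫_ℝ ≤ ⟪P x₀, x₀⟫_ℝ * Real.exp (-(2 * (β / 2)) * t) := by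
    intro t ht
    have := quadratic_lyapunov_decay (by positivity) hP hpos' hlyapG
      (fun s hs => (hx s hs.1).mono Icc_subset_Ici_self) (by rwa [hx0]) (right_mem_Icc.2 ht)
    rwa [hx0] at this
  have hxmem : ∀ t, 0 ≤ t → x t ∈ closedBall (0 : E) (R / 2) := fun t ht =>
    hsub _ ((hdecay t ht).trans (hexp t ht))
  have hxg : IsIntegralCurveOn x (fun _ => g) (Ici 0) := fun t ht => by
    have h1 : HasDerivWithinAt x (G (x t)) (Ici 0) t := hx t ht
    rwa [hGg (hxmem t ht)] at h1
  refine ⟨x, hx0, hxg, fun t ht => ?_, fun T y _ hy0 hy => ?_⟩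
  · refine le_of_sq_le_sq ?_ (by positivity)
    have h1 : (√(b / a) * Real.exp (-(β / 2) * t) * ‖x₀‖) ^ 2 =
        b / a * Real.exp (-(2 * (β / 2)) * t) * ‖x₀‖ ^ 2 := by
      rw [mul_pow, mul_pow, Real.sq_sqrt (by positivity), ← Real.exp_nat_mul]
      congr 3
      push_cast
      ring
    have h2 := (haP (x t)).trans ((hdecay t ht).trans
      (mul_le_mul_of_nonneg_right (hbP x₀) (Real.exp_pos _).le))
    rw [h1]
    calc ‖x t‖ ^ 2 ≤ (b * ‖x₀‖ ^ 2 * Real.exp (-(2 * (β / 2)) * t)) / a := by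
          rw [le_div_iff₀ ha]; linarith
      _ = _ := by ring
  -- The decay estimate for `g` itself confines any competing solution to the half ball, so
  -- Lipschitz uniqueness there suffices.
  · have hymem : ∀ t ∈ Icc 0 T, y t ∈ closedBall (0 : E) (R / 2) := fun t ht => by
      have := quadratic_lyapunov_decay (by positivity) hP hpos' hlyap hy (by rwa [hy0]) ht
      rw [hy0] at this
      exact hsub _ (this.trans (hexp t ht.1))
    exact hy.eqOn_Icc_of_lipschitzOnWith (hgR.mono hRR) hymem
      (fun t ht => (hxg t ht.1).mono Icc_subset_Ici_self) (fun t ht => hxmem t ht.1)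
      (hy0.trans hx0.symm)

end AutonomousODE

/-! ### Linear openness and the adjoint derivative. -/

section LinearOpenness

open scoped InnerProductSpace
open ContinuousLinearMap (adjoint adjoint_inner_left adjoint_inner_right)

/-- A modulus of linear openness bounds the adjoint of the derivative from below. -/
theorem LinearlyOpenWith.mul_norm_le_norm_adjoint {X Y : Type*}
    [NormedAddCommGroup X] [InnerProductSpace ℝ X] [CompleteSpace X]
    [NormedAddCommGroup Y] [InnerProductSpace ℝ Y] [CompleteSpace Y]
    {f : X → Y} {z₀ : X} {κ : ℝ} {D : X →L[ℝ] Y} (h : LinearlyOpenWith f z₀ κ) (hκ : 0 < κ)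
    (hD : HasFDerivAt f D z₀) (p : Y) : κ * ‖p‖ ≤ ‖adjoint D p‖ := by
  rcases eq_or_ne p 0 with rfl | hp
  · simp
  have hp0 : 0 < ‖p‖ := norm_pos_iff.2 hp
  refine le_of_forall_pos_le_add fun η hη => ?_
  obtain ⟨U, hU, hopen⟩ := h
  have hlin := hD.isLittleO.def (div_pos hη hp0)
  obtain ⟨r, hr, hrU⟩ := Metric.nhds_basis_closedBall.mem_iff.1 (Filter.inter_mem hU hlin)
  -- The point of the image ball farthest in the direction `p`; pairing its preimage with `p` gives
  -- the bound up to the linearization error `η`.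
  have hw : f z₀ + (κ * r / ‖p‖) • p ∈ Metric.closedBall (f z₀) (κ * r) := by
    rw [mem_closedBall_iff_norm, add_sub_cancel_left, norm_smul, Real.norm_of_nonneg (by positivity),
      div_mul_cancel₀ _ hp0.ne']
  obtain ⟨z, hz, hfz⟩ := hopen z₀ (mem_of_mem_nhds hU) r hr (fun x hx => (hrU hx).1) hw
  have hrem : ‖f z - f z₀ - D (z - z₀)‖ ≤ η / ‖p‖ * ‖z - z₀‖ := (hrU hz).2
  have hzr : ‖z - z₀‖ ≤ r := mem_closedBall_iff_norm.1 hz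
  have h1 : ⟪p, f z - f z₀⟫_ℝ = κ * ‖p‖ * r := by
    rw [hfz, add_sub_cancel_left, inner_smul_right, real_inner_self_eq_norm_sq]
    field_simp
  have h2 : ⟪p, f z - f z₀⟫_ℝ = ⟪adjoint D p, z - z₀⟫_ℝ + ⟪p, f z - f z₀ - D (z - z₀)⟫_ℝ := by
    rw [adjoint_inner_left, ← inner_add_right]; congr 1; abel
  have h3 : ⟪adjoint D p, z - z₀⟫_ℝ ≤ ‖adjoint D p‖ * r :=
    (real_inner_le_norm _ _).trans (mul_le_mul_of_nonneg_left hzr (norm_nonneg _))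
  have h4 : ⟪p, f z - f z₀ - D (z - z₀)⟫_ℝ ≤ η * r := by
    calc ⟪p, f z - f z₀ - D (z - z₀)⟫_ℝ ≤ ‖p‖ * (η / ‖p‖ * ‖z - z₀‖) :=
          (real_inner_le_norm _ _).trans (mul_le_mul_of_nonneg_left hrem hp0.le)
      _ = η * ‖z - z₀‖ := by field_simp
      _ ≤ η * r := mul_le_mul_of_nonneg_left hzr hη.le
  refine le_of_mul_le_mul_right ?_ hr
  rw [← h1, h2, add_mul]
  exact add_le_add h3 h4

end LinearOpenness

/-! ### Eigenvectors in invariant subspaces. -/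

section InvariantSubspace

open Polynomial

variable {V : Type*} [AddCommGroup V] [Module ℝ V] [FiniteDimensional ℝ V]

/-- A real endomorphism with real spectrum has an eigenvector in each nonzero invariant subspace. -/
theorem exists_eigenvector_mem_of_invariant (T : V →ₗ[ℝ] V)
    (hreal : ∀ z : ℂ, (T.charpoly.map Complex.ofRealHom).IsRoot z → z.im = 0)
    {S : Submodule ℝ V} (hS : ∀ p ∈ S, T p ∈ S) (hne : S ≠ ⊥) :
    ∃ (r : ℝ) (p : V), (T.charpoly.map Complex.ofRealHom).IsRoot (r : ℂ) ∧ p ∈ S ∧ p ≠ 0 ∧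
      T p = r • p := by
  let R : Module.End ℝ S := T.restrict hS
  have hR : ∀ (q : ℝ[X]) (p : S), ((aeval R q p : S) : V) = aeval T q p := fun q => by
    induction q using Polynomial.induction_on with
    | C a => intro p; simp [Module.algebraMap_end_apply]
    | add q₁ q₂ h₁ h₂ => intro p; simp [h₁, h₂]
    | monomial k a h =>
      intro p
      have := h (R p)
      rw [pow_succ, ← mul_assoc, map_mul (aeval R) (C a * X ^ k), map_mul (aeval T) (C a * X ^ k),
        aeval_X, aeval_X, Module.End.mul_apply,
        Module.End.mul_apply, this]
      rfl
  -- By Cayley–Hamilton the characteristic polynomial of `T` also annihilates the restriction, so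
  -- every complex root of `minpoly ℝ R` is real by `hreal`.
  have hdvd : minpoly ℝ R ∣ T.charpoly := minpoly.dvd ℝ R (by
    ext p
    rw [hR, LinearMap.aeval_self_charpoly]
    rfl)
  have : Nontrivial S := Submodule.nontrivial_iff_ne_bot.2 hne
  have hdeg : ((minpoly ℝ R).map Complex.ofRealHom).degree ≠ 0 := by
    rw [degree_map]
    exact (minpoly.degree_pos (Algebra.IsIntegral.isIntegral R)).ne'
  obtain ⟨z, hz⟩ := IsAlgClosed.exists_root _ hdeg
  have hzT : (T.charpoly.map Complex.ofRealHom).IsRoot z :=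
    hz.dvd (Polynomial.map_dvd _ hdvd)
  have hzr : ((z.re : ℝ) : ℂ) = z := Complex.ext rfl (by simp [hreal z hzT])
  rw [← hzr] at hz hzT
  have hroot : (minpoly ℝ R).IsRoot z.re := by
    have h1 : eval (Complex.ofRealHom z.re) ((minpoly ℝ R).map Complex.ofRealHom) = 0 := hz
    rw [eval_map_apply] at h1
    exact Complex.ofReal_eq_zero.1 h1
  obtain ⟨p, hp⟩ := (Module.End.hasEigenvalue_of_isRoot hroot).exists_hasEigenvector
  refine ⟨z.re, p, hzT, p.2, fun h0 => hp.2 (Subtype.ext h0), ?_⟩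
  exact congrArg Subtype.val hp.apply_eq_smul

end InvariantSubspace

/-! ### Controllability of the linearization and the main theorem. -/

section Stabilization

open scoped InnerProductSpace
open ContinuousLinearMap (adjoint adjoint_inner_left adjoint_inner_right)

variable {n m : ℕ}

/-- The inclusion `x ↦ (x, 0)` of the state space. -/
def stateInl (n m : ℕ) : EucSpace n →L[ℝ] StateControl n m :=
  ((WithLp.prodContinuousLinearEquiv 2 ℝ (EucSpace n) (EucSpace m)).symm :
    EucSpace n × EucSpace m →L[ℝ] StateControl n m) ∘L
      ContinuousLinearMap.inl ℝ (EucSpace n) (EucSpace m)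

/-- The inclusion `u ↦ (0, u)` of the control space. -/
def controlInr (n m : ℕ) : EucSpace m →L[ℝ] StateControl n m :=
  ((WithLp.prodContinuousLinearEquiv 2 ℝ (EucSpace n) (EucSpace m)).symm :
    EucSpace n × EucSpace m →L[ℝ] StateControl n m) ∘L
      ContinuousLinearMap.inr ℝ (EucSpace n) (EucSpace m)

theorem stateInl_apply (x : EucSpace n) : stateInl n m x = stateControl x 0 := rfl

theorem stateInl_add_controlInr (x : EucSpace n) (u : EucSpace m) :
    stateInl n m x + controlInr n m u = stateControl x u := by
  change WithLp.toLp 2 ((x, 0) + (0, u)) = WithLp.toLp 2 (x, u)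
  simp

/-- The adjoint has components `D* p = (A* p, B* p)`, and the second vanishes. -/
theorem norm_adjoint_of_adjoint_control_eq_zero (D : StateControl n m →L[ℝ] EucSpace n)
    {p : EucSpace n} (hp : adjoint (D ∘L controlInr n m) p = 0) :
    ‖adjoint D p‖ = ‖adjoint (D ∘L stateInl n m) p‖ := by
  have h : adjoint D p = stateInl n m (adjoint (D ∘L stateInl n m) p) := by
    refine ext_inner_right ℝ fun z => ?_
    have hz : z = stateInl n m z.fst + controlInr n m z.snd := by
      rw [stateInl_add_controlInr]; rfl
    have h1 : ⟪adjoint D p, z⟫_ℝ = ⟪adjoint (D ∘L stateInl n m) p, z.fst⟫_ℝ := by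
      have h2 : ⟪p, D (controlInr n m z.snd)⟫_ℝ = 0 := by
        have := adjoint_inner_left (D ∘L controlInr n m) z.snd p
        rw [hp, inner_zero_left] at this
        exact this.symm
      rw [adjoint_inner_left, adjoint_inner_left]
      conv_lhs => rw [hz]
      rw [map_add, inner_add_right, h2, add_zero]
      rfl
    rw [h1, stateInl_apply, WithLp.prod_inner_apply]
    simp
  rw [h, stateInl_apply]
  simp

/-- In the standard orthonormal basis `A*` has the transposed Jacobian as its matrix, and
transposition preserves the characteristic polynomial. -/
theorem charpoly_adjoint_partial_deriv {f : StateControl n m → EucSpace n}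
    {D : StateControl n m →L[ℝ] EucSpace n} (hD : HasFDerivAt f D 0) :
    ((adjoint (D ∘L stateInl n m) : EucSpace n →L[ℝ] EucSpace n) :
      EucSpace n →ₗ[ℝ] EucSpace n).charpoly = (stateJacobian f).charpoly := by
  have hA : HasFDerivAt (fun x : EucSpace n => f (stateControl x 0)) (D ∘L stateInl n m) 0 := by
    have h0 : HasFDerivAt f D (stateInl n m 0) := by rwa [map_zero]
    exact h0.comp 0 (stateInl n m).hasFDerivAt
  let b := EuclideanSpace.basisFun (Fin n) ℝ
  have hM : LinearMap.toMatrix b.toBasis b.toBasis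
      ((adjoint (D ∘L stateInl n m) : EucSpace n →L[ℝ] EucSpace n) :
        EucSpace n →ₗ[ℝ] EucSpace n) = (stateJacobian f).transpose := by
    ext i j
    rw [LinearMap.toMatrix_apply, Matrix.transpose_apply]
    change (adjoint (D ∘L stateInl n m) (b.toBasis j)) i = stateJacobian f j i
    rw [stateJacobian, Matrix.of_apply, hA.fderiv, OrthonormalBasis.coe_toBasis,
      EuclideanSpace.basisFun_apply]
    have h1 := EuclideanSpace.inner_single_right (𝕜 := ℝ) i 1
      (adjoint (D ∘L stateInl n m) (EuclideanSpace.single j 1))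
    have h2 := EuclideanSpace.inner_single_left (𝕜 := ℝ) j 1
      ((D ∘L stateInl n m) (EuclideanSpace.single i 1))
    rw [adjoint_inner_left, h2] at h1
    simpa using h1.symm
  rw [← LinearMap.charpoly_toMatrix _ b.toBasis, hM, Matrix.charpoly_transpose]

theorem isRoot_charpoly_iff_mem_spectrum_complexify (A : Matrix (Fin n) (Fin n) ℝ) (z : ℂ) :
    (A.charpoly.map Complex.ofRealHom).IsRoot z ↔ z ∈ spectrum ℂ (complexify A) := by
  rw [Matrix.mem_spectrum_iff_isRoot_charpoly, ← Matrix.charpoly_map]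
  rfl

/-- Hautus-type controllability of the linearization at `0` of a map with real partial spectrum
that is linearly open with a modulus above the partial spectral radius. -/
theorem eq_bot_of_invariant_of_linearlyOpenWith {f : StateControl n m → EucSpace n}
    {D : StateControl n m →L[ℝ] EucSpace n} (hD : HasFDerivAt f D 0) {κ : ℝ} (hκ : 0 < κ)
    (hopen : LinearlyOpenWith f 0 κ)
    (hreal : ∀ l ∈ spectrum ℂ (complexify (stateJacobian f)), l.im = 0)
    (hrad : ∀ l ∈ spectrum ℂ (complexify (stateJacobian f)), ‖l‖ < κ)
    (S : Submodule ℝ (EucSpace n)) (hSA : ∀ p ∈ S, adjoint (D ∘L stateInl n m) p ∈ S)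
    (hSB : ∀ p ∈ S, adjoint (D ∘L controlInr n m) p = 0) : S = ⊥ := by
  by_contra hne
  obtain ⟨r, p, hr, hpS, hp0, hrp⟩ := exists_eigenvector_mem_of_invariant
    ((adjoint (D ∘L stateInl n m) : EucSpace n →L[ℝ] EucSpace n) : EucSpace n →ₗ[ℝ] EucSpace n)
    (fun z hz => by
      rw [charpoly_adjoint_partial_deriv hD, isRoot_charpoly_iff_mem_spectrum_complexify] at hz
      exact hreal z hz) hSA hne
  rw [charpoly_adjoint_partial_deriv hD, isRoot_charpoly_iff_mem_spectrum_complexify] at hr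
  have hrp' : adjoint (D ∘L stateInl n m) p = r • p := hrp
  have h1 := hopen.mul_norm_le_norm_adjoint hκ hD p
  rw [norm_adjoint_of_adjoint_control_eq_zero D (hSB p hpS), hrp', norm_smul] at h1
  have h2 : ‖r‖ < κ := by simpa using hrad _ hr
  have h3 := mul_lt_mul_of_pos_right h2 (norm_pos_iff.2 hp0)
  linarith

end Stabilization

theorem corollary3p7 (n m : ℕ) (f : StateControl n m → EucSpace n)
    (hf : ContDiffAt ℝ 1 f 0)
    (hf0 : f 0 = 0)
    (hreal : ∀ l ∈ spectrum ℂ (complexify (stateJacobian f)), l.im = 0)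
    (hC : LinearlyOpen f 0 ∧
      ∃ κ : ℝ≥0, 0 < κ ∧ spectralRadius ℂ (complexify (stateJacobian f)) < (κ : ℝ≥0∞) ∧
        (κ : ℝ≥0∞) < covBound f 0) :
    LocallyExpStabilizable f := by
  obtain ⟨-, κ, -, hrad, hcov⟩ := hC
  -- The supremum exceeds `κ`, so some actual modulus `κ'` does, and it still dominates the spectral
  -- radius.
  obtain ⟨_, ⟨κ', hκ', hopen, rfl⟩, hlt⟩ := lt_sSup_iff.1 hcov
  have hstrict := hf.hasStrictFDerivAt one_ne_zero
  have hnorm : ∀ l ∈ spectrum ℂ (complexify (stateJacobian f)), ‖l‖ < κ' := fun l hl => by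
    have h1 : (‖l‖₊ : ℝ≥0∞) ≤ spectralRadius ℂ (complexify (stateJacobian f)) :=
      le_iSup₂ (f := fun (k : ℂ) (_ : k ∈ spectrum ℂ (complexify (stateJacobian f))) =>
        (‖k‖₊ : ℝ≥0∞)) l hl
    have h2 := (h1.trans_lt hrad).trans hlt
    rw [ENNReal.ofReal, ENNReal.coe_lt_coe, Real.lt_toNNReal_iff_coe_lt] at h2
    exact h2
  obtain ⟨K, P, β, hβ, hP, hpos, hM⟩ := exists_feedback_of_controllable _ _
    (eq_bot_of_invariant_of_linearlyOpenWith hstrict.hasFDerivAt hκ' hopen hreal hnorm)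
  refine ⟨K, K.continuous, map_zero K, ?_⟩
  have hgraph : ∀ x, (stateInl n m + controlInr n m ∘L K) x = stateControl x (K x) := fun x =>
    stateInl_add_controlInr x (K x)
  have hloop : HasStrictFDerivAt (closedLoop f K)
      (fderiv ℝ f 0 ∘L (stateInl n m + controlInr n m ∘L K)) 0 := by
    have h0 : HasStrictFDerivAt f (fderiv ℝ f 0) ((stateInl n m + controlInr n m ∘L K) 0) := by
      rwa [map_zero]
    have he : closedLoop f K = f ∘ (stateInl n m + controlInr n m ∘L K) :=
      funext fun x => congrArg f (hgraph x).symm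
    rw [he]
    exact h0.comp 0 (stateInl n m + controlInr n m ∘L K).hasStrictFDerivAt
  refine exists_exponential_stability hloop ?_ hβ hP hpos fun x => ?_
  · change f (stateControl 0 (K 0)) = 0
    rw [← hgraph, map_zero, hf0]
  · rw [← hM x]
    simp
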